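/- Let $q_n\in\mathbb R$ and $\lambda_n>0$ ($n\ge 1$), and let $J$ be the Jacobi operator in the complex Hilbert space $\ell^2(\mathbb N)$, $\mathbb N=\{1,2,\dots\}$, with canonical basis $(e_n)_{n\ge1}$, given by $$(Ju)(1)=q_1u(1)+\lambda_1u(2),\qquad (Ju)(n)=\lambda_{n-1}u(n-1)+q_nu(n)+\lambda_nu(n+1)\quad(n\ge2)$$ on the domain of all $u\in\ell^2(\mathbb N)$ with $Ju\in\ell^2(\mathbb N)$. Call $J$ admissible if $J=J^*$ and $\lim_{n\to\infty}\lambda_n=+\infty$. A bounded open interval $(r,s)$, $r<s$, is called a gap in the spectrum of $J$ if $(r,s)\cap\sigma(J)=\emptyset$. (1) Let $J$ be admissible and let $(r,s)$ be a gap in the spectrum of $J$. Then for every $\epsilon\in(0,1/2)$ there is $N=N(\epsilon)\ge1$, depending also on $J,r,s$ but not on $\lambda$ or $n$, such that for all $\lambda\in(r,s)$ and all $n>N$, $$|\langle (J-\lambda)^{-1}e_1,e_n\rangle|\le\frac{s-r}{\epsilon(\lambda-r)(s-\lambda)}\exp\Bigl(-\bigl(\tfrac12-\epsilon\bigr)\sqrt{(\lambda-r)(s-\lambda)}\,\sum_{k=N}^{n-1}\frac1{\lambda_k}\Bigr).$$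 (2) The constant $1/2$ is optimal: for every $\epsilon>0$ there are an admissible $J$ and a gap $(r,s)$ in its spectrum such that for no $C\in\mathbb R$ and $N\ge1$ does $$|\langle (J-\lambda)^{-1}e_1,e_n\rangle|\le C\,\frac{s-r}{(\lambda-r)(s-\lambda)}\exp\Bigl(-\bigl(\tfrac12+\epsilon\bigr)\sqrt{(\lambda-r)(s-\lambda)}\,\sum_{k=N}^{n-1}\frac1{\lambda_k}\Bigr)$$ hold for all $\lambda\in(r,s)$ and all $n>N$. -/

import Mathlib

noncomputable section

/-- The complex Hilbert space of square-summable sequences. The index `n : ℕ` is the site `n + 1` of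
the positive integers, so `n = 0` is the first site. -/
abbrev EllTwo : Type := lp (fun _ : ℕ => ℂ) 2

/-- The canonical orthonormal basis: `basisVec n` has entry `1` at index `n`, and `0` elsewhere. -/
def basisVec (n : ℕ) : EllTwo := lp.single 2 n (1 : ℂ)

/-- The difference expression of the Jacobi matrix with diagonal `q 0, q 1, …` and off-diagonal
weights `a 0, a 1, …`, where `a n` couples the indices `n` and `n + 1`. -/
def jacobiExpr (a q : ℕ → ℝ) (u : ℕ → ℂ) : ℕ → ℂ
  | 0 => (q 0 : ℂ) * u 0 + (a 0 : ℂ) * u 1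
  | n + 1 => (a n : ℂ) * u n + (q (n + 1) : ℂ) * u (n + 1) + (a (n + 1) : ℂ) * u (n + 2)

theorem jacobiExpr_add (a q : ℕ → ℝ) (u v : ℕ → ℂ) :
    jacobiExpr a q (u + v) = jacobiExpr a q u + jacobiExpr a q v := by
  funext n
  cases n <;> simp only [jacobiExpr, Pi.add_apply] <;> ring

theorem jacobiExpr_smul (a q : ℕ → ℝ) (c : ℂ) (u : ℕ → ℂ) :
    jacobiExpr a q (c • u) = c • jacobiExpr a q u := by
  funext n
  cases n <;> simp only [jacobiExpr, Pi.smul_apply, smul_eq_mul] <;> ring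

/-- The Jacobi operator in `ℓ²`, on its maximal domain of all `u ∈ ℓ²` whose image under the
difference expression is again in `ℓ²`. It is the adjoint of the restriction of the
expression to finitely supported sequences; so it is self-adjoint exactly when the expression is
essentially self-adjoint on these. -/
def jacobiOp (a q : ℕ → ℝ) : EllTwo →ₗ.[ℂ] EllTwo where
  domain :=
    { carrier := {u : EllTwo | Memℓp (jacobiExpr a q (u : ℕ → ℂ)) 2}
      add_mem' := by
        intro u v hu hv
        have h := Memℓp.add hu hv
        rw [← jacobiExpr_add] at h
        exact h
      zero_mem' := by
        have h : jacobiExpr a q ((0 : EllTwo) : ℕ → ℂ) = 0 := by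
          funext n
          cases n <;> simp [jacobiExpr]
        change Memℓp (jacobiExpr a q ((0 : EllTwo) : ℕ → ℂ)) 2
        rw [h]
        exact zero_memℓp
      smul_mem' := by
        intro c u hu
        have h := Memℓp.const_smul hu c
        rw [← jacobiExpr_smul] at h
        exact h }
  toFun :=
    { toFun := fun u => ⟨jacobiExpr a q ((u : EllTwo) : ℕ → ℂ), u.2⟩
      map_add' := fun u v =>
        Subtype.ext (jacobiExpr_add a q ((u : EllTwo) : ℕ → ℂ) ((v : EllTwo) : ℕ → ℂ))
      map_smul' := fun c u => Subtype.ext (jacobiExpr_smul a q c ((u : EllTwo) : ℕ → ℂ)) }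

/-- `R` is a bounded, everywhere defined, two-sided inverse of `T - z`. -/
def IsResolventAt (T : EllTwo →ₗ.[ℂ] EllTwo) (z : ℂ) (R : EllTwo →L[ℂ] EllTwo) : Prop :=
  (∀ f : EllTwo, ∃ h : R f ∈ T.domain, T ⟨R f, h⟩ - z • R f = f) ∧
    ∀ u : T.domain, R (T u - z • (u : EllTwo)) = u

/-- The spectrum of a (possibly unbounded) operator: all `z` for which `T - z` has no bounded
inverse. -/
def opSpectrum (T : EllTwo →ₗ.[ℂ] EllTwo) : Set ℂ :=
  {z : ℂ | ¬ ∃ R : EllTwo →L[ℂ] EllTwo, IsResolventAt T z R}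

open Classical in
/-- The resolvent `(T - z)⁻¹` for `z` outside the spectrum (and `0` for `z` in the spectrum). -/
def opResolvent (T : EllTwo →ₗ.[ℂ] EllTwo) (z : ℂ) : EllTwo →L[ℂ] EllTwo :=
  if h : ∃ R : EllTwo →L[ℂ] EllTwo, IsResolventAt T z R then Classical.choose h else 0

theorem IsResolventAt.unique {T : EllTwo →ₗ.[ℂ] EllTwo} {z : ℂ} {R R' : EllTwo →L[ℂ] EllTwo}
    (h : IsResolventAt T z R) (h' : IsResolventAt T z R') : R = R' := by
  ext1 f
  obtain ⟨hm, hf⟩ := h'.1 f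
  have h2 := h.2 ⟨R' f, hm⟩
  rw [hf] at h2
  exact h2

theorem IsResolventAt.opResolvent_eq {T : EllTwo →ₗ.[ℂ] EllTwo} {z : ℂ}
    {R : EllTwo →L[ℂ] EllTwo} (h : IsResolventAt T z R) : opResolvent T z = R := by
  have hex : ∃ R : EllTwo →L[ℂ] EllTwo, IsResolventAt T z R := ⟨R, h⟩
  rw [opResolvent, dif_pos hex]
  exact (Classical.choose_spec hex).unique h

/-- The bounded open interval `(r, s)` is a gap in the spectrum of `T`. -/
def IsSpectralGap (T : EllTwo →ₗ.[ℂ] EllTwo) (r s : ℝ) : Prop :=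
  r < s ∧ ∀ x ∈ Set.Ioo r s, (x : ℂ) ∉ opSpectrum T

/-- The sequences `a` (weights) and `q` (diagonal) define a self-adjoint Jacobi operator with
positive weights tending to infinity. -/
structure IsAdmissibleJacobi (a q : ℕ → ℝ) : Prop where
  weights_pos : ∀ n, 0 < a n
  selfAdjoint : IsSelfAdjoint (jacobiOp a q)
  weights_tendsto : Filter.Tendsto a Filter.atTop Filter.atTop

end

/-! Part (1) is a Combes–Thomas argument. Let `v` solve `(J - x) v = e_1` and set `w = e^φ v`, where
`φ` has increments `γ / a k` from `N` to `n` and `γ = (1/2 - ε) √((x - r)(s - x))`. Conjugating `J`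
by `e^φ` adds a hopping term (`jacobiExpr_weight`). To first order this term is skew-symmetric with
bounded entries `±γ`, hence of norm at most `2γ`; the remainder is `O(γ² / a k)`, small once the
weights are large. Skewness is what yields the geometric mean of the distances to `r` and `s`: the
perturbation does not contribute to `Re ⟨w, (J - x) w⟩`, so `norm_add_ge_of_gap` tolerates any skew
term of norm below `√((x - r)(s - x))`, where a plain Neumann series would require the smaller
distance. This bounds `w`, and evaluating at `n` gives the decay (`norm_apply_le_of_gap`).

For part (2), take zero diagonal and weights `1 + c, 1, 2 + c, 2, …`. Carleman's criterion gives
self-adjointness, and a telescoping estimate gives the gap `(-c, c)`. At `x = 0` the Green function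
is an explicit product of ratios `(j + 1) / (j + 1 + c)`, whose decay is at most `exp (-(c / 2) ∑ 1
/ a k)` up to a factor `1 / (m + 1 + c)`. An extra rate `ε c = 2` gains `(m + 1)⁻²`, which beats
that factor. -/

/-! ### Resolvents and spectral gaps of self-adjoint operators. -/

theorem IsSelfAdjoint.inner_apply_comm {T : EllTwo →ₗ.[ℂ] EllTwo} (hT : IsSelfAdjoint T)
    (u v : T.domain) : inner ℂ (T u) (v : EllTwo) = inner ℂ (u : EllTwo) (T v) := by
  have h := LinearPMap.adjoint_isFormalAdjoint hT.dense_domain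
  rw [LinearPMap.isSelfAdjoint_def.1 hT] at h
  exact h u v

theorem IsResolventAt.sub_eq {T : EllTwo →ₗ.[ℂ] EllTwo} {z z' : ℂ} {R R' : EllTwo →L[ℂ] EllTwo}
    (h : IsResolventAt T z R) (h' : IsResolventAt T z' R') :
    R' - R = (z' - z) • (R * R') := by
  ext1 f
  obtain ⟨hm, hf⟩ := h'.1 f
  have h2 := h.2 ⟨R' f, hm⟩
  rw [sub_eq_iff_eq_add] at hf
  rw [hf] at h2
  have h3 : f + z' • R' f - z • R' f = f + (z' - z) • R' f := by module
  simp only [h3, map_add, map_smul] at h2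
  change R' f - R f = (z' - z) • R (R' f)
  rw [sub_eq_iff_eq_add, add_comm]
  exact h2.symm

theorem IsResolventAt.isSelfAdjoint {T : EllTwo →ₗ.[ℂ] EllTwo} (hT : IsSelfAdjoint T) {x : ℝ}
    {R : EllTwo →L[ℂ] EllTwo} (h : IsResolventAt T (x : ℂ) R) : IsSelfAdjoint R := by
  rw [ContinuousLinearMap.isSelfAdjoint_iff_isSymmetric]
  intro f g
  obtain ⟨hf, ef⟩ := h.1 f
  obtain ⟨hg, eg⟩ := h.1 g
  have hs := hT.inner_apply_comm ⟨R f, hf⟩ ⟨R g, hg⟩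
  rw [sub_eq_iff_eq_add] at ef eg
  rw [ef, eg] at hs
  simp only [inner_add_left, inner_add_right, inner_smul_left, inner_smul_right,
    Complex.conj_ofReal] at hs
  exact (add_right_cancel hs).symm

/-- For a self-adjoint bounded operator the norm is the spectral radius, and a spectral value `m` of
`R` corresponds to the point `c + 1/m` of the spectrum of `T`. -/
theorem IsResolventAt.norm_le {T : EllTwo →ₗ.[ℂ] EllTwo} (hT : IsSelfAdjoint T) {c ρ : ℝ}
    (hρ : 0 < ρ) (hgap : ∀ x ∈ Set.Ioo (c - ρ) (c + ρ), (x : ℂ) ∉ opSpectrum T)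
    {R : EllTwo →L[ℂ] EllTwo} (h : IsResolventAt T (c : ℂ) R) : ‖R‖ ≤ ρ⁻¹ := by
  have hsa := h.isSelfAdjoint hT
  have hspec : ∀ μ ∈ spectrum ℂ R, ‖μ‖ ≤ ρ⁻¹ := by
    intro μ hμ
    have hre := hsa.mem_spectrum_eq_re hμ
    obtain ⟨m, rfl⟩ : ∃ m : ℝ, μ = (m : ℂ) := ⟨μ.re, hre⟩
    by_contra! hlt
    rw [Complex.norm_real, Real.norm_eq_abs] at hlt
    have hm0 : m ≠ 0 := by
      rintro rfl
      simp at hlt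
      linarith
    have hinv : |m⁻¹| < ρ := by
      rw [abs_inv]
      exact inv_lt_of_inv_lt₀ hρ hlt
    rw [abs_lt] at hinv
    have hns := hgap (c + m⁻¹) ⟨by linarith, by linarith⟩
    simp only [opSpectrum, Set.mem_ofPred_eq, not_not] at hns
    obtain ⟨R', hR'⟩ := hns
    have e1 := h.sub_eq hR'
    have e2 := hR'.sub_eq h
    push_cast at e1 e2
    have hmc : (m : ℂ) ≠ 0 := by exact_mod_cast hm0
    apply hμ
    -- Formally `m - R = m (T - c - 1/m)(T - c)⁻¹`, whose inverse is `m⁻¹ (1 + m⁻¹ R')`.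
    refine ⟨⟨algebraMap ℂ _ (m : ℂ) - R,
      (m : ℂ)⁻¹ • (1 + (m : ℂ)⁻¹ • R'), ?_, ?_⟩, rfl⟩
    · have e3 : R * R' = (m : ℂ) • (R' - R) := by
        rw [e1, smul_smul]
        simp [hmc]
      rw [Algebra.algebraMap_eq_smul_one]
      simp only [sub_mul, mul_smul_comm, smul_mul_assoc, mul_add, one_mul, mul_one, e3, smul_smul,
        smul_add, smul_sub]
      simp [hmc]
    · have e3 : R' * R = (m : ℂ) • (R' - R) := by
        have : R' - R = (m : ℂ)⁻¹ • (R' * R) := by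
          rw [← neg_sub, e2, ← neg_smul]; congr 1; ring
        rw [this, smul_smul]
        simp [hmc]
      rw [Algebra.algebraMap_eq_smul_one]
      simp only [mul_sub, mul_smul_comm, smul_mul_assoc, add_mul, one_mul, mul_one, e3, smul_smul,
        smul_add, smul_sub]
      simp [hmc]
  have h1 : spectralRadius ℂ R ≤ ENNReal.ofReal ρ⁻¹ := by
    refine iSup₂_le fun μ hμ => ?_
    rw [← enorm_eq_nnnorm, ← ofReal_norm]
    exact ENNReal.ofReal_le_ofReal (hspec μ hμ)
  rw [IsSelfAdjoint.spectralRadius_eq_nnnorm hsa, ← enorm_eq_nnnorm, ← ofReal_norm] at h1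
  exact (ENNReal.ofReal_le_ofReal_iff (by positivity)).1 h1

theorem IsSpectralGap.norm_sub_ge {T : EllTwo →ₗ.[ℂ] EllTwo} (hT : IsSelfAdjoint T) {r s : ℝ}
    (hgap : IsSpectralGap T r s) (u : T.domain) :
    (s - r) / 2 * ‖(u : EllTwo)‖ ≤ ‖T u - (((r + s) / 2 : ℝ) : ℂ) • (u : EllTwo)‖ := by
  have hrs := hgap.1
  have hns := hgap.2 ((r + s) / 2) ⟨by linarith, by linarith⟩
  simp only [opSpectrum, Set.mem_ofPred_eq, not_not] at hns
  obtain ⟨R, hR⟩ := hns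
  have hρ : 0 < (s - r) / 2 := by linarith
  have hn := hR.norm_le hT hρ (fun x hx => hgap.2 x ⟨by linarith [hx.1], by linarith [hx.2]⟩)
  have h1 := R.le_of_opNorm_le hn (T u - (((r + s) / 2 : ℝ) : ℂ) • (u : EllTwo))
  rw [hR.2 u] at h1
  calc (s - r) / 2 * ‖(u : EllTwo)‖ ≤ (s - r) / 2 * (((s - r) / 2)⁻¹ * _) := by gcongr
    _ = _ := by rw [← mul_assoc, mul_inv_cancel₀ hρ.ne', one_mul]

/-- A self-adjoint operator has a bounded inverse at each real point at which it is bounded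
below. -/
theorem IsSelfAdjoint.notMem_opSpectrum {T : EllTwo →ₗ.[ℂ] EllTwo} (hT : IsSelfAdjoint T)
    {x m : ℝ} (hm : 0 < m)
    (hlow : ∀ u : T.domain, m * ‖(u : EllTwo)‖ ≤ ‖T u - (x : ℂ) • (u : EllTwo)‖) :
    (x : ℂ) ∉ opSpectrum T := by
  simp only [opSpectrum, Set.mem_ofPred_eq, not_not]
  let S : T.domain →ₗ[ℂ] EllTwo := T.toFun - (x : ℂ) • T.domain.subtype
  have hS : ∀ u : T.domain, S u = T u - (x : ℂ) • (u : EllTwo) := fun u => rfl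
  have hlowS : ∀ u : T.domain, m * ‖(u : EllTwo)‖ ≤ ‖S u‖ := hlow
  have hinj : Function.Injective S := by
    rw [injective_iff_map_eq_zero]
    intro u hu
    have := hlowS u
    rw [hu, norm_zero] at this
    have h0 : ‖(u : EllTwo)‖ = 0 := by
      nlinarith [norm_nonneg (u : EllTwo)]
    exact Subtype.ext (norm_eq_zero.1 h0)
  have hclosed : IsClosed (LinearMap.range S : Set EllTwo) := by
    rw [← isSeqClosed_iff_isClosed]
    intro y f hy hf
    choose u hu using hy
    have hc : CauchySeq fun n => (u n : EllTwo) := by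
      have hyc := hf.cauchySeq
      rw [Metric.cauchySeq_iff] at hyc ⊢
      intro ε hε
      obtain ⟨N, hN⟩ := hyc (m * ε) (by positivity)
      refine ⟨N, fun k hk l hl => ?_⟩
      have h1 := hN k hk l hl
      rw [dist_eq_norm, ← hu k, ← hu l, ← map_sub] at h1
      have h2 := hlowS (u k - u l)
      rw [dist_eq_norm]
      rw [Submodule.coe_sub] at h2
      exact lt_of_mul_lt_mul_left (h2.trans_lt h1) hm.le
    obtain ⟨v, hv⟩ := cauchySeq_tendsto_of_complete hc
    have hTv : Filter.Tendsto (fun n => T (u n)) Filter.atTop (nhds (f + (x : ℂ) • v)) := by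
      have : (fun n => T (u n)) = fun n => y n + (x : ℂ) • (u n : EllTwo) := by
        funext n
        rw [← hu n, hS]
        abel
      rw [this]
      exact hf.add (hv.const_smul _)
    have hmem : (v, f + (x : ℂ) • v) ∈ T.graph := by
      refine (hT.isClosed).mem_of_tendsto (hv.prodMk_nhds hTv) (Filter.Eventually.of_forall ?_)
      intro n
      exact T.mem_graph (u n)
    rw [LinearPMap.mem_graph_iff] at hmem
    obtain ⟨w, hw1, hw2⟩ := hmem
    simp only at hw1 hw2
    refine ⟨w, ?_⟩
    rw [hS, hw2, hw1]
    abel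
  -- A vector orthogonal to the range is an eigenvector of `T* = T` at `x`, which the lower bound
  -- excludes.
  have hbot : (LinearMap.range S)ᗮ = ⊥ := by
    rw [Submodule.eq_bot_iff]
    intro f hf
    rw [Submodule.mem_orthogonal'] at hf
    have hf' : ∀ u : T.domain, inner ℂ ((x : ℂ) • f) (u : EllTwo) = inner ℂ f (T u) := by
      intro u
      have := hf (S u) ⟨u, rfl⟩
      rw [hS, inner_sub_right, inner_smul_right, sub_eq_zero] at this
      rw [this, inner_smul_left, Complex.conj_ofReal]
    have hmem : f ∈ (LinearPMap.adjoint T).domain :=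
      LinearPMap.mem_adjoint_domain_of_exists f ⟨_, hf'⟩
    have hval := LinearPMap.adjoint_apply_eq hT.dense_domain ⟨f, hmem⟩ hf'
    have key : ∀ A : EllTwo →ₗ.[ℂ] EllTwo, A = T → ∀ h : f ∈ A.domain,
        A ⟨f, h⟩ = (x : ℂ) • f → f = 0 := by
      rintro A rfl h hA
      have := hlow ⟨f, h⟩
      rw [hA, sub_self, norm_zero] at this
      have h0 : ‖f‖ = 0 := by
        simp only at this
        nlinarith [norm_nonneg f]
      exact norm_eq_zero.1 h0
    exact key _ (LinearPMap.isSelfAdjoint_def.1 hT) hmem hval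
  have hsurj : Function.Surjective S := by
    rw [← LinearMap.range_eq_top]
    have : IsComplete (LinearMap.range S : Set EllTwo) := hclosed.isComplete
    have : CompleteSpace (LinearMap.range S) := this.completeSpace_coe
    exact Submodule.orthogonal_eq_bot_iff.1 hbot
  let e := LinearEquiv.ofBijective S ⟨hinj, hsurj⟩
  have he : ∀ u, e u = S u := fun u => rfl
  let R : EllTwo →L[ℂ] EllTwo :=
    (T.domain.subtype ∘ₗ (e.symm : EllTwo →ₗ[ℂ] T.domain)).mkContinuous m⁻¹ (by
      intro f
      have h1 := hlowS (e.symm f)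
      rw [← he, e.apply_symm_apply] at h1
      rw [inv_mul_eq_div, le_div_iff₀' hm]
      exact h1)
  have hR : ∀ f, R f = (e.symm f : EllTwo) := fun f => rfl
  refine ⟨R, fun f => ⟨(e.symm f).2, ?_⟩, fun u => ?_⟩
  · have := hS (e.symm f)
    rw [← he, e.apply_symm_apply] at this
    exact this.symm
  · rw [hR, ← hS, ← he, e.symm_apply_apply]

/-! ### Coordinates and norms in `ℓ²`. -/

theorem norm_inner_basisVec (f : EllTwo) (n : ℕ) : ‖inner ℂ f (basisVec n)‖ = ‖f n‖ := by
  rw [basisVec, lp.inner_single_right]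
  simp

theorem jacobiOp_apply_coe (a q : ℕ → ℝ) (u : (jacobiOp a q).domain) :
    ((jacobiOp a q u : EllTwo) : ℕ → ℂ) = jacobiExpr a q ((u : EllTwo) : ℕ → ℂ) := rfl

theorem ellTwo_sum_sq_le (f : EllTwo) (s : Finset ℕ) : ∑ i ∈ s, ‖f i‖ ^ 2 ≤ ‖f‖ ^ 2 := by
  have h := lp.sum_rpow_le_norm_rpow (p := 2) (by norm_num) f s
  simpa using h

theorem ellTwo_hasSum_sq (f : EllTwo) : HasSum (fun i => ‖f i‖ ^ 2) (‖f‖ ^ 2) := by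
  have h := lp.hasSum_norm (p := 2) (by norm_num) f
  simpa using h

theorem ellTwo_norm_le {f : EllTwo} {C : ℝ} (hC : 0 ≤ C)
    (h : ∀ n, ∑ i ∈ Finset.range n, ‖f i‖ ^ 2 ≤ C ^ 2) : ‖f‖ ≤ C := by
  have := le_of_tendsto' (ellTwo_hasSum_sq f).tendsto_sum_nat h
  exact (pow_le_pow_iff_left₀ (norm_nonneg _) hC two_ne_zero).1 this

/-! ### Combes–Thomas estimate. -/

/-- Coercivity of a symmetric operator with a gap `(-e, d)` in its spectrum under a skew-symmetric
perturbation of relative size `θ`: here `h` is the image of `w` under the operator, and `g` its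
image under the perturbation. -/
theorem norm_add_ge_of_gap {E : Type*} [NormedAddCommGroup E] [InnerProductSpace ℂ E]
    {d e θ : ℝ} (hd : 0 < d) (he : 0 < e) (hθ : 0 ≤ θ) (hθ1 : θ < 1) {w h g : E}
    (hlow : (d + e) / 2 * ‖w‖ ≤ ‖h - (((d - e) / 2 : ℝ) : ℂ) • w‖)
    (hre : (inner ℂ w g).re = 0) (hg : ‖g‖ ≤ θ * √(d * e) * ‖w‖) :
    (1 - θ) * min d e * ‖w‖ ≤ ‖h + g‖ := by
  set q := √(d * e) with hq
  have hq0 : 0 ≤ q := Real.sqrt_nonneg _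
  have hq2 : q ^ 2 = d * e := Real.sq_sqrt (by positivity)
  have hamgm : 2 * q ≤ d + e := by
    have : (2 * q) ^ 2 ≤ (d + e) ^ 2 := by nlinarith [sq_nonneg (d - e)]
    exact (pow_le_pow_iff_left₀ (by positivity) (by positivity) two_ne_zero).1 this
  set t := ‖h + g‖ with ht
  have ht0 : 0 ≤ t := norm_nonneg _
  set W := ‖w‖ with hW
  have hW0 : 0 ≤ W := norm_nonneg _
  have hh : ‖h‖ ≤ t + θ * q * W := by
    calc ‖h‖ = ‖(h + g) - g‖ := by rw [add_sub_cancel_right]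
      _ ≤ ‖h + g‖ + ‖g‖ := norm_sub_le _ _
      _ ≤ _ := by gcongr
  have hp : |(inner ℂ w h).re| ≤ W * t := by
    have h1 : (inner ℂ w h).re = (inner ℂ w (h + g)).re := by
      rw [inner_add_right, Complex.add_re, hre, add_zero]
    rw [h1]
    exact (Complex.abs_re_le_norm _).trans (norm_inner_le_norm _ _)
  have hsq : ‖h - (((d - e) / 2 : ℝ) : ℂ) • w‖ ^ 2 =
      ‖h‖ ^ 2 - (d - e) * (inner ℂ w h).re + ((d - e) / 2) ^ 2 * W ^ 2 := by
    rw [@norm_sub_sq ℂ, inner_smul_right, norm_smul, Complex.norm_real, mul_pow,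
      Real.norm_eq_abs, sq_abs, ← inner_conj_symm h w]
    simp only [RCLike.re_to_complex, Complex.re_ofReal_mul, Complex.conj_re]
    ring
  have hlow2 : ((d + e) / 2 * W) ^ 2 ≤
      ‖h‖ ^ 2 - (d - e) * (inner ℂ w h).re + ((d - e) / 2) ^ 2 * W ^ 2 := by
    rw [← hsq]
    gcongr
  have hh2 : ‖h‖ ^ 2 ≤ (t + θ * q * W) ^ 2 := by gcongr
  have hcross : -((d - e) * (inner ℂ w h).re) ≤ |d - e| * (W * t) := by
    calc _ ≤ |(d - e) * (inner ℂ w h).re| := neg_le_abs _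
      _ = |d - e| * |(inner ℂ w h).re| := abs_mul _ _
      _ ≤ _ := by gcongr
  -- Squaring `hlow` gives `d e ‖w‖² ≤ ‖h‖² - (d - e) Re ⟨w, h⟩`. The skewness of `g` bounds the
  -- cross term by `‖w‖ t`, and `‖h‖ ≤ t + θ q ‖w‖`.
  have hmain : (1 - θ ^ 2) * (d * e) * W ^ 2 ≤ t ^ 2 + 2 * θ * q * W * t + |d - e| * (W * t) := by
    have : (θ * q * W) ^ 2 = θ ^ 2 * (d * e) * W ^ 2 := by rw [mul_pow, mul_pow, hq2]
    nlinarith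
  by_contra! hlt
  have hW1 : 0 < W := by
    rcases hW0.eq_or_lt with h0 | h0
    · rw [← h0, mul_zero] at hlt
      linarith
    · exact h0
  obtain ⟨m, M, hm, hmin, habs, hmul, hsum, hmM⟩ : ∃ m M : ℝ, 0 < m ∧ min d e = m ∧
      |d - e| = M - m ∧ d * e = m * M ∧ d + e = m + M ∧ m ≤ M := by
    rcases le_total d e with h1 | h1
    · exact ⟨d, e, hd, min_eq_left h1, by rw [abs_of_nonpos (by linarith)]; ring, rfl, rfl, h1⟩
    · exact ⟨e, d, he, min_eq_right h1, abs_of_nonneg (by linarith), mul_comm _ _,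
        add_comm _ _, h1⟩
  rw [hmin] at hlt
  rw [habs, hmul] at hmain
  rw [hsum] at hamgm
  set b := (1 - θ) * m * W with hb
  have hη : 0 < 1 - θ := by linarith
  have s1 : t ^ 2 < b ^ 2 := by gcongr
  have s2 : (2 * θ * q * W + (M - m) * W) * t ≤ (2 * θ * q * W + (M - m) * W) * b := by
    have : 0 ≤ M - m := by linarith
    gcongr
  -- The difference of the two sides is a nonnegative multiple of `m + M - 2 q`, so this is the
  -- arithmetic–geometric mean inequality.
  have s3 : b ^ 2 + (2 * θ * q * W + (M - m) * W) * b ≤ (1 - θ ^ 2) * (m * M) * W ^ 2 := by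
    have e1 : (1 - θ ^ 2) * (m * M) * W ^ 2 - (b ^ 2 + (2 * θ * q * W + (M - m) * W) * b) =
        (1 - θ) * m * W ^ 2 * (θ * (m + M - 2 * q)) := by rw [hb]; ring
    have e2 : 0 ≤ (1 - θ) * m * W ^ 2 * (θ * (m + M - 2 * q)) := by
      have : 0 ≤ m + M - 2 * q := by linarith
      positivity
    linarith
  nlinarith

/-- The off-diagonal difference expression with superdiagonal `α` and subdiagonal `β`. -/
noncomputable def hopExpr (α β : ℕ → ℝ) (w : ℕ → ℂ) : ℕ → ℂ
  | 0 => (α 0 : ℂ) * w 1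
  | k + 1 => (β k : ℂ) * w k + (α (k + 1) : ℂ) * w (k + 2)

theorem sum_norm_hopExpr_sq_le {α β : ℕ → ℝ} {B : ℝ} (hα : ∀ k, |α k| ≤ B)
    (hβ : ∀ k, |β k| ≤ B) (w : ℕ → ℂ) (n : ℕ) :
    ∑ i ∈ Finset.range (n + 1), ‖hopExpr α β w i‖ ^ 2 ≤
      2 * B ^ 2 * (∑ i ∈ Finset.range n, ‖w i‖ ^ 2 + ∑ i ∈ Finset.range (n + 1), ‖w (i + 1)‖ ^ 2) := by
  have hB : 0 ≤ B := (abs_nonneg _).trans (hα 0)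
  induction n with
  | zero =>
    simp only [hopExpr, zero_add, Finset.range_one, Finset.sum_singleton, Finset.range_zero,
      Finset.sum_empty, norm_mul, Complex.norm_real, Real.norm_eq_abs, mul_pow]
    have : |α 0| ^ 2 ≤ B ^ 2 := by gcongr; exact hα 0
    nlinarith [sq_nonneg ‖w 1‖, sq_nonneg B]
  | succ n ih =>
    rw [Finset.sum_range_succ, Finset.sum_range_succ (fun i => ‖w i‖ ^ 2),
      Finset.sum_range_succ (fun i => ‖w (i + 1)‖ ^ 2) (n + 1)]
    have h1 : ‖hopExpr α β w (n + 1)‖ ≤ B * ‖w n‖ + B * ‖w (n + 2)‖ := by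
      simp only [hopExpr]
      refine (norm_add_le _ _).trans ?_
      rw [norm_mul, norm_mul, Complex.norm_real, Complex.norm_real]
      gcongr
      · exact hβ n
      · exact hα (n + 1)
    have h2 : ‖hopExpr α β w (n + 1)‖ ^ 2 ≤ (B * ‖w n‖ + B * ‖w (n + 2)‖) ^ 2 := by gcongr
    nlinarith [sq_nonneg (B * ‖w n‖ - B * ‖w (n + 2)‖)]

theorem exists_hopExpr {α β : ℕ → ℝ} {B : ℝ} (hα : ∀ k, |α k| ≤ B) (hβ : ∀ k, |β k| ≤ B)
    (w : EllTwo) : ∃ z : EllTwo, (z : ℕ → ℂ) = hopExpr α β w ∧ ‖z‖ ≤ 2 * B * ‖w‖ := by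
  have hB : 0 ≤ B := (abs_nonneg _).trans (hα 0)
  have hsum : ∀ n, ∑ i ∈ Finset.range n, ‖hopExpr α β w i‖ ^ 2 ≤ (2 * B * ‖w‖) ^ 2 := by
    intro n
    have h0 := ellTwo_sum_sq_le w (Finset.range n)
    have h1 := ellTwo_sum_sq_le w (Finset.range (n + 2))
    rw [Finset.sum_range_succ'] at h1
    calc ∑ i ∈ Finset.range n, ‖hopExpr α β w i‖ ^ 2
        ≤ ∑ i ∈ Finset.range (n + 1), ‖hopExpr α β w i‖ ^ 2 := by
          rw [Finset.sum_range_succ]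
          linarith [sq_nonneg ‖hopExpr α β w n‖]
      _ ≤ _ := sum_norm_hopExpr_sq_le hα hβ w n
      _ ≤ 2 * B ^ 2 * (‖w‖ ^ 2 + ‖w‖ ^ 2) := by
          gcongr
          linarith [sq_nonneg ‖w 0‖]
      _ = _ := by ring
  have hmem : Memℓp (hopExpr α β w) 2 := by
    refine memℓp_gen ?_
    simp only [ENNReal.toReal_ofNat, Real.rpow_ofNat]
    exact summable_of_sum_range_le (fun _ => sq_nonneg _) hsum
  exact ⟨⟨_, hmem⟩, rfl, ellTwo_norm_le (by positivity) hsum⟩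

/-- Skew-symmetry up to a boundary term: each bond contributes twice with opposite signs, except the
last. -/
theorem sum_re_inner_hopExpr_neg (χ : ℕ → ℝ) (w : ℕ → ℂ) (n : ℕ) :
    ∑ i ∈ Finset.range (n + 1), (inner ℂ (w i) (hopExpr (fun k => -χ k) χ w i)).re =
      -χ n * (inner ℂ (w n) (w (n + 1))).re := by
  induction n with
  | zero => simp [hopExpr]; ring
  | succ n ih =>
    rw [Finset.sum_range_succ, ih]
    simp [hopExpr]
    ring

theorem re_inner_hopExpr_neg_eq_zero {χ : ℕ → ℝ} {m : ℕ} (hχ : ∀ k ≥ m, χ k = 0)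
    {w z : EllTwo} (hz : (z : ℕ → ℂ) = hopExpr (fun k => -χ k) χ w) :
    (inner ℂ w z).re = 0 := by
  have h1 := ((lp.hasSum_inner w z).mapL Complex.reCLM).tendsto_sum_nat
  rw [hz] at h1
  have h2 := h1.comp (Filter.tendsto_add_atTop_nat 1)
  refine tendsto_nhds_unique h2 (tendsto_const_nhds.congr' ?_)
  filter_upwards [Filter.eventually_ge_atTop m] with n hn
  have := sum_re_inner_hopExpr_neg χ w n
  rw [hχ n hn, neg_zero, zero_mul] at this
  exact this.symm

/-- Conjugation of the Jacobi expression by a weight. -/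
theorem jacobiExpr_weight (a q φ : ℕ → ℝ) (v : ℕ → ℂ) (k : ℕ) :
    jacobiExpr a q (fun j => (Real.exp (φ j) : ℂ) * v j) k +
      hopExpr (fun j => a j * (Real.exp (-(φ (j + 1) - φ j)) - 1))
        (fun j => a j * (Real.exp (φ (j + 1) - φ j) - 1))
        (fun j => (Real.exp (φ j) : ℂ) * v j) k =
      (Real.exp (φ k) : ℂ) * jacobiExpr a q v k := by
  have h1 : ∀ j, (Real.exp (φ j) : ℂ) =
      (Real.exp (-(φ (j + 1) - φ j)) : ℂ) * (Real.exp (φ (j + 1)) : ℂ) := by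
    intro j
    rw [← Complex.ofReal_mul, ← Real.exp_add]
    congr 2
    ring
  have h2 : ∀ j, (Real.exp (φ (j + 1)) : ℂ) =
      (Real.exp (φ (j + 1) - φ j) : ℂ) * (Real.exp (φ j) : ℂ) := by
    intro j
    rw [← Complex.ofReal_mul, ← Real.exp_add]
    congr 2
    ring
  cases k with
  | zero =>
    simp only [jacobiExpr, hopExpr]
    have := h1 0
    simp only [zero_add] at this
    push_cast at this ⊢
    linear_combination -(a 0 : ℂ) * v 1 * this
  | succ k =>
    simp only [jacobiExpr, hopExpr]
    have e1 := h1 (k + 1)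
    have e2 := h2 k
    push_cast at e1 e2 ⊢
    linear_combination -(a (k + 1) : ℂ) * v (k + 2) * e1 - (a k : ℂ) * v k * e2

theorem abs_exp_sub_one_sub_id_mul_le {a γ χ : ℝ} (ha : 0 < a) (hγ : |γ| ≤ a) (hχ : χ = 0 ∨ χ = 1) :
    |a * (Real.exp (γ * χ / a) - 1) - γ * χ| ≤ γ ^ 2 * χ / a := by
  rcases hχ with rfl | rfl
  · simp
  · have h1 : |γ * 1 / a| ≤ 1 := by
      rw [mul_one, abs_div, abs_of_pos ha]
      exact (div_le_one ha).2 hγ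
    have h2 := Real.abs_exp_sub_one_sub_id_le h1
    have e1 : a * (Real.exp (γ * 1 / a) - 1) - γ * 1 = a * (Real.exp (γ * 1 / a) - 1 - γ * 1 / a) := by
      field_simp
    rw [e1, abs_mul, abs_of_pos ha]
    calc _ ≤ a * (γ * 1 / a) ^ 2 := by gcongr
      _ = _ := by field_simp

/-- The Combes–Thomas estimate for the first column of the Green function. -/
theorem norm_apply_le_of_gap {a q : ℕ → ℝ} (ha : ∀ n, 0 < a n)
    (hT : IsSelfAdjoint (jacobiOp a q)) {r s : ℝ} (hgap : IsSpectralGap (jacobiOp a q) r s)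
    {ε : ℝ} (hε : ε ∈ Set.Ioo (0 : ℝ) (1 / 2)) {N : ℕ} (hN : ∀ k ≥ N, (s - r) / (2 * ε) ≤ a k)
    {x : ℝ} (hx : x ∈ Set.Ioo r s) (v : (jacobiOp a q).domain)
    (hv : jacobiOp a q v - (x : ℂ) • (v : EllTwo) = basisVec 0) (n : ℕ) :
    ‖(v : EllTwo) n‖ ≤ (s - r) / (ε * (x - r) * (s - x)) *
      Real.exp (-(1 / 2 - ε) * √((x - r) * (s - x)) * ∑ k ∈ Finset.Ico N n, 1 / a k) := by
  obtain ⟨hε0, hε1⟩ := hε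
  have he : 0 < x - r := by linarith [hx.1]
  have hd : 0 < s - x := by linarith [hx.2]
  have hrs : 0 < s - r := by linarith
  have hD : 0 < (x - r) * (s - x) := by positivity
  set Q := √((x - r) * (s - x)) with hQ
  have hQ0 : 0 ≤ Q := Real.sqrt_nonneg _
  have hQ2 : Q ^ 2 = (x - r) * (s - x) := Real.sq_sqrt hD.le
  have hQs : 2 * Q ≤ s - r := by
    have : (2 * Q) ^ 2 ≤ (s - r) ^ 2 := by nlinarith [sq_nonneg ((x - r) - (s - x))]
    exact (pow_le_pow_iff_left₀ (by positivity) (by positivity) two_ne_zero).1 this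
  set γ := (1 / 2 - ε) * Q with hγ
  have hγ0 : 0 ≤ γ := mul_nonneg (by linarith) hQ0
  have hγQ : γ ≤ Q / 2 := by nlinarith
  set A := (s - r) / (2 * ε) with hA
  have hA0 : 0 < A := by positivity
  have hAs : s - r ≤ A := by
    rw [hA, le_div_iff₀ (by positivity)]
    nlinarith
  have hγA : γ ≤ A := by linarith
  -- The cutoff at `n` keeps `φ` bounded, so that `w ∈ ℓ²`, and removes the boundary term of the
  -- skew part. The cutoff at `N` avoids the sites with small weights.
  set χ : ℕ → ℝ := fun k => if N ≤ k ∧ k < n then 1 else 0 with hχ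
  have hχ01 : ∀ k, χ k = 0 ∨ χ k = 1 := by
    intro k
    simp only [hχ]
    split_ifs <;> simp
  have hχN : ∀ k, χ k ≠ 0 → A ≤ a k := by
    intro k hk
    simp only [hχ, ne_eq, ite_eq_right_iff, not_forall] at hk
    exact hN k hk.1.1
  set φ : ℕ → ℝ := fun k => ∑ j ∈ Finset.range k, γ * χ j / a j with hφ
  have hφsucc : ∀ k, φ (k + 1) - φ k = γ * χ k / a k := by
    intro k
    simp only [hφ, Finset.sum_range_succ]
    ring
  have hφn : ∀ k ≥ n, φ k = γ * ∑ j ∈ Finset.Ico N n, 1 / a j := by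
    intro k hk
    have e1 : ∀ j, γ * χ j / a j = if N ≤ j ∧ j < n then γ * (1 / a j) else 0 := by
      intro j
      simp only [hχ]
      split_ifs <;> ring
    simp only [hφ, e1]
    rw [← Finset.sum_filter, Finset.mul_sum]
    refine Finset.sum_congr ?_ fun _ _ => rfl
    ext j
    simp only [Finset.mem_filter, Finset.mem_range, Finset.mem_Ico]
    constructor
    · exact fun h => h.2
    · exact fun h => ⟨by omega, h⟩
  have hφmono : Monotone φ := by
    refine monotone_nat_of_le_succ fun k => ?_
    have h1 : 0 ≤ γ * χ k / a k := by
      have := ha k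
      rcases hχ01 k with h | h <;> rw [h] <;> positivity
    linarith [hφsucc k]
  have hφle : ∀ k, φ k ≤ φ n := by
    intro k
    rcases le_total k n with h | h
    · exact hφmono h
    · rw [hφn k h, hφn n le_rfl]
  have hwmem : Memℓp (fun j => (Real.exp (φ j) : ℂ) * (v : EllTwo) j) 2 := by
    have h1 : Memℓp (fun j => ((Real.exp (φ n) : ℂ) • ((v : EllTwo) : ℕ → ℂ)) j) 2 :=
      (lp.memℓp (v : EllTwo)).const_smul _
    refine h1.mono' fun j => ?_
    simp only [Pi.smul_apply, smul_eq_mul, norm_mul, Complex.norm_real, Real.norm_eq_abs,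
      Real.abs_exp]
    gcongr
    exact hφle j
  set w : EllTwo := ⟨_, hwmem⟩ with hw
  have hwc : (w : ℕ → ℂ) = fun j => (Real.exp (φ j) : ℂ) * (v : EllTwo) j := rfl
  obtain ⟨g, hg, hgn⟩ := exists_hopExpr (α := fun k => -(γ * χ k)) (β := fun k => γ * χ k) (B := γ)
    (fun k => by
      rw [abs_neg]
      rcases hχ01 k with h | h <;> simp [h, abs_of_nonneg hγ0, hγ0])
    (fun k => by rcases hχ01 k with h | h <;> simp [h, abs_of_nonneg hγ0, hγ0]) w
  have herr : ∀ k, γ ^ 2 * χ k / a k ≤ γ ^ 2 / A := by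
    intro k
    by_cases hk : χ k = 0
    · rw [hk]
      simp only [mul_zero, zero_div]
      positivity
    · have h1 := hχN k hk
      have h2 : χ k = 1 := (hχ01 k).resolve_left hk
      rw [h2, mul_one]
      gcongr
  have herr' : ∀ k (σ : ℝ), |σ| = γ →
      |a k * (Real.exp (σ * χ k / a k) - 1) - σ * χ k| ≤ γ ^ 2 / A := by
    intro k σ hσ
    by_cases hk : χ k = 0
    · rw [hk]
      simp only [mul_zero, zero_div, Real.exp_zero, sub_self, abs_zero]
      positivity
    · refine (abs_exp_sub_one_sub_id_mul_le (ha k) ?_ (hχ01 k)).trans ?_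
      · rw [hσ]
        exact hγA.trans (hχN k hk)
      · rw [← sq_abs σ, hσ]
        exact herr k
  -- The hopping term splits as `g + p`: `g` is its linear part in `γ`, `p` the Taylor remainder.
  obtain ⟨p, hp, hpn⟩ := exists_hopExpr
    (α := fun k => a k * (Real.exp (-(φ (k + 1) - φ k)) - 1) + γ * χ k)
    (β := fun k => a k * (Real.exp (φ (k + 1) - φ k) - 1) - γ * χ k) (B := γ ^ 2 / A)
    (fun k => by
      have := herr' k (-γ) (by rw [abs_neg, abs_of_nonneg hγ0])
      rw [hφsucc]
      convert this using 2
      rw [show -(γ * χ k / a k) = -γ * χ k / a k by ring]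
      ring)
    (fun k => by
      rw [hφsucc]
      exact herr' k γ (abs_of_nonneg hγ0)) w
  have hEv : ∀ k, jacobiExpr a q w k = ((x : ℂ) • w + basisVec 0 - g - p) k := by
    intro k
    have h1 := jacobiExpr_weight a q φ ((v : EllTwo) : ℕ → ℂ) k
    rw [← hwc] at h1
    have h2 : jacobiExpr a q ((v : EllTwo) : ℕ → ℂ) k =
        (x : ℂ) * (v : EllTwo) k + basisVec 0 k := by
      have h3 := congrArg (fun f : EllTwo => f k) (sub_eq_iff_eq_add.1 hv)
      simp only [jacobiOp_apply_coe, lp.coeFn_add, Pi.add_apply, lp.coeFn_smul, Pi.smul_apply,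
        smul_eq_mul] at h3
      rw [h3, add_comm]
    -- Since `φ 0 = 0`, the weight leaves the source at the first site unchanged.
    have h4 : (Real.exp (φ k) : ℂ) * basisVec 0 k = basisVec 0 k := by
      rcases Nat.eq_zero_or_pos k with rfl | hk
      · simp [hφ]
      · rw [basisVec, lp.single_apply_ne _ _ _ hk.ne', mul_zero]
    have h5 : hopExpr (fun j => a j * (Real.exp (-(φ (j + 1) - φ j)) - 1))
        (fun j => a j * (Real.exp (φ (j + 1) - φ j) - 1)) w k = g k + p k := by
      rw [hg, hp]
      cases k <;> simp only [hopExpr] <;> push_cast <;> ring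
    rw [h5, h2, mul_add, h4] at h1
    have h6 : (w : ℕ → ℂ) k = (Real.exp (φ k) : ℂ) * (v : EllTwo) k := rfl
    simp only [lp.coeFn_add, Pi.add_apply, lp.coeFn_smul, Pi.smul_apply, smul_eq_mul,
      lp.coeFn_sub, Pi.sub_apply]
    rw [h6]
    linear_combination h1
  have hwdom : w ∈ (jacobiOp a q).domain := by
    change Memℓp (jacobiExpr a q w) 2
    rw [funext hEv]
    exact lp.memℓp _
  have hJw : jacobiOp a q ⟨w, hwdom⟩ = (x : ℂ) • w + basisVec 0 - g - p :=
    lp.ext (funext hEv)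
  set m := min (s - x) (x - r) with hm
  have hm0 : 0 < m := lt_min hd he
  have hmM : (x - r) * (s - x) ≤ m * (s - r) := by
    rcases le_total (s - x) (x - r) with h | h
    · rw [hm, min_eq_left h]; nlinarith
    · rw [hm, min_eq_right h]; nlinarith
  -- Here `θ = 1 - 2ε`, because `‖g‖ ≤ 2γ ‖w‖ = (1 - 2ε) Q ‖w‖`.
  have hlow : (1 - (1 - 2 * ε)) * min (s - x) (x - r) * ‖w‖ ≤
      ‖(jacobiOp a q ⟨w, hwdom⟩ - (x : ℂ) • w) + g‖ := by
    refine norm_add_ge_of_gap hd he (by linarith) (by linarith) ?_ ?_ ?_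
    · have h1 := hgap.norm_sub_ge hT ⟨w, hwdom⟩
      have e1 : (s - x + (x - r)) / 2 = (s - r) / 2 := by ring
      have e2 : (x : ℂ) + ((((s - x) - (x - r)) / 2 : ℝ) : ℂ) = (((r + s) / 2 : ℝ) : ℂ) := by
        push_cast
        ring
      rw [e1, sub_sub, ← add_smul, e2]
      exact h1
    · exact re_inner_hopExpr_neg_eq_zero (χ := fun k => γ * χ k) (m := n) (fun k hk => by
        simp [hχ, not_lt.2 hk]) hg
    · refine hgn.trans_eq ?_
      rw [hγ, mul_comm (s - x), ← hQ]
      ring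
  have hsum : (jacobiOp a q ⟨w, hwdom⟩ - (x : ℂ) • w) + g = basisVec 0 - p := by
    rw [hJw]
    abel
  have he0 : ‖basisVec 0‖ = 1 := by
    rw [basisVec, lp.norm_single (by norm_num)]
    simp
  rw [hsum, ← hm] at hlow
  -- The choice of `A` makes the remainder cost half of the coercivity constant `2 ε m`, using `γ ≤
  -- Q / 2` and `Q² ≤ m (s - r)`.
  have hpn' : ‖p‖ ≤ ε * m * ‖w‖ := by
    refine hpn.trans (mul_le_mul_of_nonneg_right ?_ (norm_nonneg _))
    have h1 : γ ^ 2 ≤ (Q / 2) ^ 2 := by gcongr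
    have h2 : 2 * γ ^ 2 ≤ m * (s - r) / 2 := by nlinarith
    have h3 : ε * m * A = m * (s - r) / 2 := by
      rw [hA]
      field_simp
    rw [← mul_div_assoc, div_le_iff₀ hA0]
    linarith
  have hwn : ε * m * ‖w‖ ≤ 1 := by
    have := norm_sub_le (basisVec 0) p
    rw [he0] at this
    linarith
  have hfin : ‖w n‖ ≤ ‖w‖ := lp.norm_apply_le_norm (by norm_num) w n
  rw [show w n = (Real.exp (φ n) : ℂ) * (v : EllTwo) n from rfl, norm_mul, Complex.norm_real,
    Real.norm_eq_abs, Real.abs_exp, hφn n le_rfl] at hfin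
  have hexp : -(1 / 2 - ε) * Q * ∑ k ∈ Finset.Ico N n, 1 / a k =
      -(γ * ∑ k ∈ Finset.Ico N n, 1 / a k) := by
    rw [hγ]
    ring
  rw [hexp, Real.exp_neg, ← div_eq_mul_inv, le_div_iff₀ (Real.exp_pos _), mul_comm]
  refine hfin.trans ?_
  rw [le_div_iff₀ (by positivity)]
  calc ‖w‖ * (ε * (x - r) * (s - x)) = ε * ‖w‖ * ((x - r) * (s - x)) := by ring
    _ ≤ ε * ‖w‖ * (m * (s - r)) := by gcongr
    _ = (ε * m * ‖w‖) * (s - r) := by ring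
    _ ≤ 1 * (s - r) := by gcongr
    _ = s - r := one_mul _

theorem exists_opResolvent_eq {T : EllTwo →ₗ.[ℂ] EllTwo} {z : ℂ} (hz : z ∉ opSpectrum T)
    (f : EllTwo) : ∃ v : T.domain, opResolvent T z f = v ∧ T v - z • (v : EllTwo) = f := by
  simp only [opSpectrum, Set.mem_ofPred_eq, not_not] at hz
  obtain ⟨R, hR⟩ := hz
  obtain ⟨h, e⟩ := hR.1 f
  exact ⟨⟨R f, h⟩, by rw [hR.opResolvent_eq], e⟩

theorem exists_green_bound {a q : ℕ → ℝ} (hJ : IsAdmissibleJacobi a q) {r s : ℝ}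
    (hgap : IsSpectralGap (jacobiOp a q) r s) {ε : ℝ} (hε : ε ∈ Set.Ioo (0 : ℝ) (1 / 2)) :
    ∃ N : ℕ, ∀ x ∈ Set.Ioo r s, ∀ n > N,
      ‖inner ℂ (opResolvent (jacobiOp a q) (x : ℂ) (basisVec 0)) (basisVec n)‖ ≤
        (s - r) / (ε * (x - r) * (s - x)) *
          Real.exp (-(1 / 2 - ε) * Real.sqrt ((x - r) * (s - x)) *
            ∑ k ∈ Finset.Ico N n, 1 / a k) := by
  obtain ⟨N, hN⟩ := Filter.eventually_atTop.1
    (hJ.weights_tendsto.eventually_ge_atTop ((s - r) / (2 * ε)))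
  refine ⟨N, fun x hx n _ => ?_⟩
  obtain ⟨v, hv, hv'⟩ := exists_opResolvent_eq (hgap.2 x hx) (basisVec 0)
  rw [norm_inner_basisVec, hv]
  exact norm_apply_le_of_gap hJ.weights_pos hJ.selfAdjoint hgap hε hN hx v hv' n

/-! ### Carleman's criterion for self-adjointness. -/

/-- Otherwise `1 / b n ≤ f n / η` eventually, and the divergent series would converge. This makes
boundary terms vanish along a subsequence. -/
theorem frequently_mul_lt_of_summable {f b : ℕ → ℝ} (hb : ∀ n, 0 < b n) (hf : Summable f)
    (hbs : ¬ Summable fun n => 1 / b n) {η : ℝ} (hη : 0 < η) :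
    ∃ᶠ n in Filter.atTop, b n * f n < η := by
  by_contra h
  rw [Filter.not_frequently] at h
  apply hbs
  obtain ⟨N, hN⟩ := Filter.eventually_atTop.1 h
  rw [← summable_nat_add_iff N]
  refine Summable.of_nonneg_of_le (fun n => (one_div_pos.2 (hb _)).le) (fun n => ?_)
    (((summable_nat_add_iff N).2 hf).mul_left η⁻¹)
  have h1 := not_lt.1 (hN (n + N) (by omega))
  have h2 := hb (n + N)
  rw [div_le_iff₀ h2, inv_mul_eq_div, div_mul_eq_mul_div, le_div_iff₀ hη]
  linarith

theorem ellTwo_summable_sq (f : EllTwo) : Summable fun i => ‖f i‖ ^ 2 :=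
  (ellTwo_hasSum_sq f).summable

theorem ellTwo_hasSum_inner (f g : EllTwo) :
    HasSum (fun i => inner ℂ (f i) (g i)) (inner ℂ f g) :=
  lp.hasSum_inner f g

theorem jacobiExpr_green (a q : ℕ → ℝ) (u v : ℕ → ℂ) (n : ℕ) :
    ∑ i ∈ Finset.range (n + 1), (inner ℂ (jacobiExpr a q u i) (v i) -
      inner ℂ (u i) (jacobiExpr a q v i)) =
      (a n : ℂ) * (inner ℂ (u (n + 1)) (v n) - inner ℂ (u n) (v (n + 1))) := by
  induction n with
  | zero =>
    simp [jacobiExpr]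
    ring
  | succ n ih =>
    rw [Finset.sum_range_succ, ih]
    simp [jacobiExpr]
    ring

/-- By Green's formula the defect is the limit of boundary terms `a n` times a summable quantity,
which are arbitrarily small infinitely often. -/
theorem jacobiOp_inner_comm {a q : ℕ → ℝ} (ha : ∀ n, 0 < a n)
    (has : ¬ Summable fun n => 1 / a n) (u v : (jacobiOp a q).domain) :
    inner ℂ (jacobiOp a q u) (v : EllTwo) = inner ℂ (u : EllTwo) (jacobiOp a q v) := by
  have h1 := ((ellTwo_hasSum_inner (jacobiOp a q u) (v : EllTwo)).sub
    (ellTwo_hasSum_inner (u : EllTwo) (jacobiOp a q v))).tendsto_sum_nat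
  have h2 := (h1.comp (Filter.tendsto_add_atTop_nat 1)).norm
  set f : ℕ → ℝ := fun n => ‖(u : EllTwo) (n + 1)‖ * ‖(v : EllTwo) n‖ +
    ‖(u : EllTwo) n‖ * ‖(v : EllTwo) (n + 1)‖ with hf
  have hfs : Summable f := by
    have su := ellTwo_summable_sq (u : EllTwo)
    have sv := ellTwo_summable_sq (v : EllTwo)
    refine Summable.of_nonneg_of_le (fun n => by positivity) (fun n => ?_)
      (((summable_nat_add_iff 1).2 su).add (sv.add (su.add ((summable_nat_add_iff 1).2 sv))))
    simp only [hf]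
    nlinarith [sq_nonneg (‖(u : EllTwo) (n + 1)‖ - ‖(v : EllTwo) n‖),
      sq_nonneg (‖(u : EllTwo) n‖ - ‖(v : EllTwo) (n + 1)‖),
      sq_nonneg (‖(u : EllTwo) (n + 1)‖), sq_nonneg ‖(v : EllTwo) n‖,
      sq_nonneg (‖(u : EllTwo) n‖), sq_nonneg ‖(v : EllTwo) (n + 1)‖]
  rw [← sub_eq_zero, ← norm_le_zero_iff]
  refine le_of_forall_pos_le_add fun η hη => ?_
  rw [zero_add]
  refine le_of_tendsto_of_frequently h2
    ((frequently_mul_lt_of_summable ha hfs has hη).mono fun n hn => ?_)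
  have h3 := jacobiExpr_green a q (u : EllTwo) (v : EllTwo) n
  simp only [Function.comp, jacobiOp_apply_coe]
  rw [h3, norm_mul, Complex.norm_real, Real.norm_of_nonneg (ha n).le]
  refine le_trans ?_ hn.le
  have := (ha n).le
  gcongr
  refine (norm_sub_le _ _).trans ?_
  exact add_le_add (norm_inner_le_norm _ _) (norm_inner_le_norm _ _)

theorem basisVec_apply (k n : ℕ) : basisVec k n = if n = k then 1 else 0 := by
  rw [basisVec, lp.single_apply, Pi.single_apply]

theorem jacobiExpr_basisVec_zero (a q : ℕ → ℝ) :
    jacobiExpr a q (basisVec 0) =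
      (((q 0 : ℂ) • basisVec 0 + (a 0 : ℂ) • basisVec 1 : EllTwo) : ℕ → ℂ) := by
  funext n
  simp only [lp.coeFn_add, lp.coeFn_smul, Pi.add_apply, Pi.smul_apply, smul_eq_mul, basisVec_apply]
  rcases n with _ | _ | n <;> simp [jacobiExpr, basisVec_apply]

theorem jacobiExpr_basisVec_succ (a q : ℕ → ℝ) (k : ℕ) :
    jacobiExpr a q (basisVec (k + 1)) =
      (((a k : ℂ) • basisVec k + (q (k + 1) : ℂ) • basisVec (k + 1) +
        (a (k + 1) : ℂ) • basisVec (k + 2) : EllTwo) : ℕ → ℂ) := by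
  funext n
  simp only [lp.coeFn_add, lp.coeFn_smul, Pi.add_apply, Pi.smul_apply, smul_eq_mul, basisVec_apply]
  rcases n with _ | n
  · rcases k with _ | k <;> simp [jacobiExpr, basisVec_apply]
  · simp only [jacobiExpr, basisVec_apply]
    by_cases h1 : n = k + 1
    · subst h1
      have e : k + 1 + 1 ≠ k := by omega
      simp [e]
    · by_cases h2 : n = k
      · subst h2
        simp
      · by_cases h3 : n + 1 = k
        · subst h3
          simp only [h1, ↓reduceIte, mul_zero, zero_add, mul_one]
          simp
        · have e1 : n + 1 ≠ k + 1 := by omega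
          have e2 : n + 2 ≠ k + 1 := by omega
          have e3 : n + 1 ≠ k + 2 := by omega
          simp only [h1, h3, e1, e2, e3, if_false, mul_zero, add_zero]

theorem basisVec_mem_domain (a q : ℕ → ℝ) (k : ℕ) : basisVec k ∈ (jacobiOp a q).domain := by
  change Memℓp (jacobiExpr a q (basisVec k)) 2
  rcases k with _ | k
  · rw [jacobiExpr_basisVec_zero]
    exact lp.memℓp _
  · rw [jacobiExpr_basisVec_succ]
    exact lp.memℓp _

theorem dense_jacobiOp_domain (a q : ℕ → ℝ) : Dense ((jacobiOp a q).domain : Set EllTwo) := by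
  intro f
  refine mem_closure_of_tendsto (lp.hasSum_single (by norm_num) f)
    (Filter.Eventually.of_forall fun s => ?_)
  refine Submodule.sum_mem _ fun i _ => ?_
  have h1 : lp.single 2 i (f i) = f i • basisVec i := by
    rw [basisVec, ← lp.single_smul, smul_eq_mul, mul_one]
  rw [h1]
  exact Submodule.smul_mem _ _ (basisVec_mem_domain a q i)

/-- Testing against basis vectors shows that the adjoint acts by the same difference expression. -/
theorem jacobiExpr_eq_of_forall_inner {a q : ℕ → ℝ} {y z : EllTwo}
    (h : ∀ x : (jacobiOp a q).domain, inner ℂ z (x : EllTwo) = inner ℂ y (jacobiOp a q x)) :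
    jacobiExpr a q y = z := by
  have hb : ∀ (f : EllTwo) (k : ℕ), inner ℂ f (basisVec k) = (starRingEnd ℂ) (f k) := by
    intro f k
    rw [basisVec, lp.inner_single_right]
    simp
  funext k
  have hk := h ⟨basisVec k, basisVec_mem_domain a q k⟩
  rw [hb] at hk
  rcases k with _ | k
  · have e : jacobiOp a q ⟨basisVec 0, basisVec_mem_domain a q 0⟩ = _ :=
      lp.ext (jacobiExpr_basisVec_zero a q)
    rw [e, inner_add_right, inner_smul_right, inner_smul_right, hb, hb] at hk
    apply (starRingEnd ℂ).injective
    rw [hk]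
    simp [jacobiExpr]
  · have e : jacobiOp a q ⟨basisVec (k + 1), basisVec_mem_domain a q (k + 1)⟩ = _ :=
      lp.ext (jacobiExpr_basisVec_succ a q k)
    rw [e, inner_add_right, inner_add_right, inner_smul_right, inner_smul_right,
      inner_smul_right, hb, hb, hb] at hk
    apply (starRingEnd ℂ).injective
    rw [hk]
    simp [jacobiExpr]

/-- Carleman's criterion. -/
theorem isSelfAdjoint_jacobiOp {a q : ℕ → ℝ} (ha : ∀ n, 0 < a n)
    (has : ¬ Summable fun n => 1 / a n) : IsSelfAdjoint (jacobiOp a q) := by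
  have hd := dense_jacobiOp_domain a q
  rw [LinearPMap.isSelfAdjoint_def]
  refine le_antisymm ?_ ?_
  · have key : ∀ y : (LinearPMap.adjoint (jacobiOp a q)).domain,
        jacobiExpr a q (y : EllTwo) = (LinearPMap.adjoint (jacobiOp a q) y : EllTwo) := fun y =>
      jacobiExpr_eq_of_forall_inner fun x => LinearPMap.adjoint_isFormalAdjoint hd y x
    refine ⟨fun y hy => ?_, fun y x hxy => ?_⟩
    · change Memℓp (jacobiExpr a q y) 2
      rw [key ⟨y, hy⟩]
      exact lp.memℓp _
    · refine lp.ext ?_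
      rw [jacobiOp_apply_coe, ← hxy, key]
  · exact LinearPMap.IsFormalAdjoint.le_adjoint hd fun u v => jacobiOp_inner_comm ha has u v

/-! ### The extremal example and its spectral gap. -/

/-- The weights `1 + c, 1, 2 + c, 2, 3 + c, 3, …`. -/
noncomputable def staggeredWeight (c : ℝ) (n : ℕ) : ℝ := ((n / 2 : ℕ) : ℝ) + 1 + if n % 2 = 0 then c else 0

theorem staggeredWeight_even (c : ℝ) (j : ℕ) : staggeredWeight c (2 * j) = j + 1 + c := by
  simp [staggeredWeight]

theorem staggeredWeight_odd (c : ℝ) (j : ℕ) : staggeredWeight c (2 * j + 1) = j + 1 := by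
  have h1 : (2 * j + 1) / 2 = j := by omega
  simp [staggeredWeight, h1]

theorem staggeredWeight_ge {c : ℝ} (hc : 0 ≤ c) (n : ℕ) :
    ((n / 2 : ℕ) : ℝ) + 1 ≤ staggeredWeight c n := by
  unfold staggeredWeight
  split_ifs <;> linarith

theorem staggeredWeight_pos {c : ℝ} (hc : 0 ≤ c) (n : ℕ) : 0 < staggeredWeight c n :=
  lt_of_lt_of_le (by positivity) (staggeredWeight_ge hc n)

theorem not_summable_one_div_nat_add_one : ¬ Summable fun n : ℕ => 1 / ((n : ℝ) + 1) := by
  have h := Real.not_summable_one_div_natCast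
  rw [← summable_nat_add_iff 1] at h
  simpa using h

theorem isAdmissibleJacobi_staggeredWeight {c : ℝ} (hc : 0 ≤ c) :
    IsAdmissibleJacobi (staggeredWeight c) 0 where
  weights_pos := staggeredWeight_pos hc
  selfAdjoint := by
    refine isSelfAdjoint_jacobiOp (staggeredWeight_pos hc) fun h => ?_
    refine not_summable_one_div_nat_add_one ?_
    have h1 := h.comp_injective (i := fun j : ℕ => 2 * j + 1) fun i j hij => by simpa using hij
    simpa [Function.comp_def, staggeredWeight_odd] using h1
  weights_tendsto := by
    refine Filter.tendsto_atTop_mono (f := fun n : ℕ => (n : ℝ) / 2) (fun n => ?_)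
      (tendsto_natCast_atTop_atTop.atTop_div_const two_pos)
    have h1 := staggeredWeight_ge hc n
    have h2 : (n : ℝ) ≤ 2 * ((n / 2 : ℕ) : ℝ) + 1 := by
      have : n ≤ 2 * (n / 2) + 1 := by omega
      exact_mod_cast this
    linarith

/-- After the reverse triangle inequality, the two sides differ by `P Q (‖z‖ - ‖w‖)²`. -/
theorem le_norm_add_sq {P Q : ℝ} (hP : 0 ≤ P) (hQ : 0 ≤ Q) (z w : ℂ) :
    P * (P - Q) * ‖z‖ ^ 2 + Q * (Q - P) * ‖w‖ ^ 2 ≤ ‖(P : ℂ) * z + (Q : ℂ) * w‖ ^ 2 := by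
  have h1 := abs_norm_sub_norm_le ((P : ℂ) * z) (-((Q : ℂ) * w))
  rw [sub_neg_eq_add, norm_neg, norm_mul, norm_mul, Complex.norm_real, Complex.norm_real,
    Real.norm_of_nonneg hP, Real.norm_of_nonneg hQ] at h1
  have h2 : (P * ‖z‖ - Q * ‖w‖) ^ 2 ≤ ‖(P : ℂ) * z + (Q : ℂ) * w‖ ^ 2 := by
    rw [← sq_abs]
    gcongr
  have h3 : 0 ≤ P * Q * (‖z‖ - ‖w‖) ^ 2 := by positivity
  nlinarith

/-- Applying `le_norm_add_sq` to each row, neighbouring contributions at a site add up to `c² + c`.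
The boundary terms are kept explicit for the induction; only the one at `2 * n` is negative. -/
theorem sum_norm_staggered_ge {c : ℝ} (hc : 0 ≤ c) (u : ℕ → ℂ) (n : ℕ) :
    c ^ 2 * ∑ i ∈ Finset.range (2 * n), ‖u i‖ ^ 2 +
      (n + 1 + c) * (1 + c) * ‖u (2 * n + 1)‖ ^ 2 - c * n * ‖u (2 * n)‖ ^ 2 ≤
      ∑ i ∈ Finset.range (2 * n + 1), ‖jacobiExpr (staggeredWeight c) 0 u i‖ ^ 2 := by
  induction n with
  | zero =>
    have h0 := staggeredWeight_even c 0
    simp only [mul_zero] at h0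
    simp only [mul_zero, Finset.range_zero, Finset.sum_empty, zero_add, Finset.range_one,
      Finset.sum_singleton, jacobiExpr, Pi.zero_apply, Complex.ofReal_zero, zero_mul, h0,
      norm_mul, Complex.norm_real, mul_pow, Real.norm_eq_abs, sq_abs]
    push_cast
    nlinarith
  | succ n ih =>
    have e1 : 2 * (n + 1) = 2 * n + 1 + 1 := by ring
    rw [e1, Finset.sum_range_succ _ (2 * n + 1 + 1), Finset.sum_range_succ _ (2 * n + 1),
      Finset.sum_range_succ _ (2 * n + 1), Finset.sum_range_succ _ (2 * n)]
    have ha : staggeredWeight c (2 * n + 1 + 1) = n + 1 + 1 + c := by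
      have := staggeredWeight_even c (n + 1)
      rw [e1] at this
      rw [this]
      push_cast
      ring
    have h1 := le_norm_add_sq (P := n + 1 + c) (Q := n + 1) (by positivity) (by positivity)
      (u (2 * n)) (u (2 * n + 1 + 1))
    have h2 := le_norm_add_sq (P := n + 1) (Q := n + 1 + 1 + c) (by positivity) (by positivity)
      (u (2 * n + 1)) (u (2 * n + 1 + 1 + 1))
    have r1 : jacobiExpr (staggeredWeight c) 0 u (2 * n + 1) =
        ((n + 1 + c : ℝ) : ℂ) * u (2 * n) + ((n + 1 : ℝ) : ℂ) * u (2 * n + 1 + 1) := by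
      simp only [jacobiExpr, staggeredWeight_even, staggeredWeight_odd, Pi.zero_apply,
        Complex.ofReal_zero, zero_mul, add_zero]
    have r2 : jacobiExpr (staggeredWeight c) 0 u (2 * n + 1 + 1) =
        ((n + 1 : ℝ) : ℂ) * u (2 * n + 1) + ((n + 1 + 1 + c : ℝ) : ℂ) * u (2 * n + 1 + 1 + 1) := by
      simp only [jacobiExpr, ha, staggeredWeight_odd, Pi.zero_apply,
        Complex.ofReal_zero, zero_mul, add_zero]
    rw [r1, r2]
    push_cast at h1 h2 ih ⊢
    nlinarith [mul_nonneg hc (sq_nonneg ‖u (2 * n)‖), mul_nonneg hc (sq_nonneg ‖u (2 * n + 1)‖)]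

theorem norm_jacobiOp_staggered_ge {c : ℝ} (hc : 0 ≤ c)
    (u : (jacobiOp (staggeredWeight c) 0).domain) :
    c * ‖(u : EllTwo)‖ ≤ ‖jacobiOp (staggeredWeight c) 0 u‖ := by
  have hlim : Filter.Tendsto
      (fun n => c ^ 2 * ∑ i ∈ Finset.range (2 * n), ‖(u : EllTwo) i‖ ^ 2) Filter.atTop
      (nhds (c ^ 2 * ‖(u : EllTwo)‖ ^ 2)) :=
    (((ellTwo_hasSum_sq (u : EllTwo)).tendsto_sum_nat.comp
      (Filter.tendsto_id.const_mul_atTop' two_pos)).const_mul _)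
  have hs : Summable fun n => c * ‖(u : EllTwo) (2 * n)‖ ^ 2 :=
    ((ellTwo_summable_sq (u : EllTwo)).comp_injective (i := fun n : ℕ => 2 * n)
      fun i j hij => by simpa using hij).mul_left c
  have hsq : (c * ‖(u : EllTwo)‖) ^ 2 ≤ ‖jacobiOp (staggeredWeight c) 0 u‖ ^ 2 := by
    rw [mul_pow]
    refine le_of_forall_pos_le_add fun η hη => ?_
    -- The negative boundary term `c n ‖u (2n)‖²` is small infinitely often, since `∑ c ‖u (2n)‖²`
    -- converges and the harmonic series diverges.
    refine le_of_tendsto_of_frequently hlim ((frequently_mul_lt_of_summable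
      (b := fun n : ℕ => (n : ℝ) + 1) (fun n => by positivity) hs
      not_summable_one_div_nat_add_one hη).mono fun n hn => ?_)
    have h1 := sum_norm_staggered_ge hc (u : EllTwo) n
    have h2 := ellTwo_sum_sq_le (jacobiOp (staggeredWeight c) 0 u)
      (Finset.range (2 * n + 1))
    rw [jacobiOp_apply_coe] at h2
    have h3 : 0 ≤ (n + 1 + c) * (1 + c) * ‖(u : EllTwo) (2 * n + 1)‖ ^ 2 := by positivity
    have h4 : 0 ≤ c * ‖(u : EllTwo) (2 * n)‖ ^ 2 := by positivity
    nlinarith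
  exact (pow_le_pow_iff_left₀ (by positivity) (norm_nonneg _) two_ne_zero).1 hsq

theorem isSpectralGap_staggered {c : ℝ} (hc : 0 < c) :
    IsSpectralGap (jacobiOp (staggeredWeight c) 0) (-c) c := by
  refine ⟨by linarith, fun x hx => ?_⟩
  refine (isAdmissibleJacobi_staggeredWeight hc.le).selfAdjoint.notMem_opSpectrum
    (m := c - |x|) (sub_pos.2 (abs_lt.2 hx)) fun u => ?_
  have h1 := norm_jacobiOp_staggered_ge hc.le u
  have h2 := norm_sub_norm_le (jacobiOp (staggeredWeight c) 0 u) ((x : ℂ) • (u : EllTwo))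
  rw [norm_smul, Complex.norm_real, Real.norm_eq_abs] at h2
  linarith

/-! ### Optimality of the constant, at the centre of the gap. -/

/-- With `t = log (p / r)`, the exponent is `-sinh t`, and `t ≤ sinh t`. Equivalently, the
trapezoidal rule overestimates the integral of `1 / x`. -/
theorem exp_neg_trapezoid_le {r p : ℝ} (hr : 0 < r) (hrp : r ≤ p) :
    Real.exp (-((p - r) / 2 * (1 / p + 1 / r))) ≤ r / p := by
  have hp : 0 < p := hr.trans_le hrp
  have ht : 0 ≤ Real.log (p / r) := Real.log_nonneg ((one_le_div hr).2 hrp)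
  have h1 := Real.self_le_sinh_iff.2 ht
  have h2 : Real.sinh (Real.log (p / r)) = (p - r) / 2 * (1 / p + 1 / r) := by
    rw [Real.sinh_log (by positivity)]
    field_simp
    ring
  calc _ ≤ Real.exp (-Real.log (p / r)) := by
        rw [← h2]
        gcongr
    _ = r / p := by rw [Real.exp_neg, Real.exp_log (by positivity), inv_div]

/-- At energy zero with zero diagonal, the even rows determine the odd-indexed entries recursively.
Each step multiplies `(m + 1 + c) ‖u (2m + 1)‖` by `(m + 1) / (m + 1 + c)`, which the trapezoid
bound compares with two terms of the sum. -/
theorem exp_neg_sum_le_norm_apply {c : ℝ} (hc : 0 < c) {u : ℕ → ℂ}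
    (hu : jacobiExpr (staggeredWeight c) 0 u = basisVec 0) (m : ℕ) :
    Real.exp (-(c / 2 * ∑ k ∈ Finset.range (2 * m), 1 / staggeredWeight c k)) ≤
      (m + 1 + c) * ‖u (2 * m + 1)‖ := by
  induction m with
  | zero =>
    have h := congrFun hu 0
    have h0 := staggeredWeight_even c 0
    simp only [mul_zero] at h0
    simp only [jacobiExpr, Pi.zero_apply, Complex.ofReal_zero, zero_mul, zero_add, h0] at h
    have h1 := congrArg norm h
    rw [norm_mul, Complex.norm_real, Real.norm_of_nonneg (by positivity)] at h1
    simp only [mul_zero, Finset.range_zero, Finset.sum_empty, neg_zero, Real.exp_zero, zero_add]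
    rw [h1]
    simp [basisVec]
  | succ m ih =>
    have e1 : 2 * (m + 1) = 2 * m + 1 + 1 := by ring
    have ha : staggeredWeight c (2 * m + 1 + 1) = m + 1 + 1 + c := by
      have := staggeredWeight_even c (m + 1)
      rw [e1] at this
      rw [this]
      push_cast
      ring
    have h := congrFun hu (2 * m + 1 + 1)
    have hb : basisVec 0 (2 * m + 1 + 1) = 0 := lp.single_apply_ne _ _ _ (by omega)
    simp only [jacobiExpr, Pi.zero_apply, Complex.ofReal_zero, zero_mul, add_zero, ha,
      staggeredWeight_odd, hb] at h
    have h1 := congrArg norm (eq_neg_of_add_eq_zero_right h)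
    rw [norm_neg, norm_mul, norm_mul, Complex.norm_real, Complex.norm_real,
      Real.norm_of_nonneg (by positivity), Real.norm_of_nonneg (by positivity)] at h1
    have h2 := exp_neg_trapezoid_le (r := m + 1) (p := m + 1 + c) (by positivity) (by linarith)
    rw [e1, Finset.sum_range_succ, Finset.sum_range_succ, staggeredWeight_even,
      staggeredWeight_odd]
    push_cast
    rw [h1]
    have h3 : -(c / 2 * (∑ k ∈ Finset.range (2 * m), 1 / staggeredWeight c k +
        1 / ((m : ℝ) + 1 + c) + 1 / ((m : ℝ) + 1))) =
        -((m + 1 + c - (m + 1)) / 2 * (1 / ((m : ℝ) + 1 + c) + 1 / ((m : ℝ) + 1))) +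
        -(c / 2 * ∑ k ∈ Finset.range (2 * m), 1 / staggeredWeight c k) := by ring
    rw [h3, Real.exp_add]
    calc _ ≤ ((m : ℝ) + 1) / (m + 1 + c) * ((m + 1 + c) * ‖u (2 * m + 1)‖) := by gcongr
      _ = _ := by field_simp

theorem add_one_le_exp_sum_staggered {c : ℝ} (hc : 0 ≤ c) (m : ℕ) :
    (m : ℝ) + 1 ≤ Real.exp (∑ k ∈ Finset.range (2 * m), 1 / staggeredWeight c k) := by
  induction m with
  | zero => simp
  | succ m ih =>
    have e1 : 2 * (m + 1) = 2 * m + 1 + 1 := by ring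
    rw [e1, Finset.sum_range_succ, Finset.sum_range_succ, staggeredWeight_even,
      staggeredWeight_odd]
    have h1 := Real.add_one_le_exp (1 / ((m : ℝ) + 1))
    have h2 : 0 ≤ 1 / ((m : ℝ) + 1 + c) := by positivity
    calc ((m + 1 : ℕ) : ℝ) + 1 = (m + 1) * (1 / ((m : ℝ) + 1) + 1) := by
          push_cast
          field_simp
          ring
      _ ≤ Real.exp (∑ k ∈ Finset.range (2 * m), 1 / staggeredWeight c k) *
          Real.exp (1 / ((m : ℝ) + 1)) := by gcongr
      _ = Real.exp (∑ k ∈ Finset.range (2 * m), 1 / staggeredWeight c k + 1 / ((m : ℝ) + 1)) := by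
          rw [Real.exp_add]
      _ ≤ _ := by
          gcongr
          linarith

theorem exists_green_gt {ε c : ℝ} (hε : 0 < ε) (hc : 0 < c) (hεc : ε * c = 2)
    (C : ℝ) (N : ℕ) : ∃ x ∈ Set.Ioo (-c) c, ∃ n > N,
      C * ((c - -c) / ((x - -c) * (c - x))) *
          Real.exp (-(1 / 2 + ε) * Real.sqrt ((x - -c) * (c - x)) *
            ∑ k ∈ Finset.Ico N n, 1 / staggeredWeight c k) <
        ‖inner ℂ (opResolvent (jacobiOp (staggeredWeight c) 0) (x : ℂ) (basisVec 0))
          (basisVec n)‖ := by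
  have h0 : (0 : ℝ) ∈ Set.Ioo (-c) c := ⟨by linarith, hc⟩
  obtain ⟨v, hv, hv'⟩ := exists_opResolvent_eq ((isSpectralGap_staggered hc).2 0 h0) (basisVec 0)
  rw [Complex.ofReal_zero, zero_smul, sub_zero] at hv'
  have hu : jacobiExpr (staggeredWeight c) 0 (v : EllTwo) = basisVec 0 := by
    rw [← jacobiOp_apply_coe, hv']
  set S : ℕ → ℝ := fun n => ∑ k ∈ Finset.range n, 1 / staggeredWeight c k with hS
  -- `K` collects the prefactor and the missing part of the sum below `N`.
  set K := |C| * (2 / c) * Real.exp ((1 / 2 + ε) * c * S N) with hK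
  have hK0 : 0 ≤ K := by positivity
  obtain ⟨m, hm⟩ := exists_nat_gt (max (N : ℝ) (K * (1 + c)))
  have hmN : N < m := by exact_mod_cast (le_max_left _ _).trans_lt hm
  have hmK : K * (1 + c) < m := (le_max_right _ _).trans_lt hm
  refine ⟨0, h0, 2 * m + 1, by omega, ?_⟩
  rw [norm_inner_basisVec, hv]
  have hlow := exp_neg_sum_le_norm_apply hc hu m
  have hgrow := add_one_le_exp_sum_staggered hc.le m
  change (m : ℝ) + 1 ≤ Real.exp (S (2 * m)) at hgrow
  change Real.exp (-(c / 2 * S (2 * m))) ≤ _ at hlow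
  have hsqrt : √((0 - -c) * (c - 0)) = c := by
    rw [zero_sub, neg_neg, sub_zero, Real.sqrt_mul_self hc.le]
  have hfrac : (c - -c) / ((0 - -c) * (c - 0)) = 2 / c := by
    have : (c - -c) = 2 * c := by ring
    rw [this, zero_sub, neg_neg, sub_zero, mul_div_mul_right _ _ hc.ne']
  have hSico : S (2 * m) - S N ≤ ∑ k ∈ Finset.Ico N (2 * m + 1), 1 / staggeredWeight c k := by
    rw [Finset.sum_Ico_eq_sub _ (by omega), Finset.sum_range_succ]
    have := staggeredWeight_pos hc.le (2 * m)
    have : 0 ≤ 1 / staggeredWeight c (2 * m) := by positivity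
    simp only [hS]
    linarith
  rw [hsqrt, hfrac]
  have hmc : 0 < (m : ℝ) + 1 + c := by positivity
  calc C * (2 / c) * Real.exp (-(1 / 2 + ε) * c *
          ∑ k ∈ Finset.Ico N (2 * m + 1), 1 / staggeredWeight c k)
      ≤ |C| * (2 / c) * Real.exp (-(1 / 2 + ε) * c * (S (2 * m) - S N)) := by
        have h1 : 0 ≤ (1 / 2 + ε) * c := by positivity
        have h2 := mul_le_mul_of_nonneg_left hSico h1
        gcongr ?_ * _ * Real.exp ?_
        · exact le_abs_self C
        · linarith
    -- As `ε c = 2`, the rate is `(1/2 + ε) c = c/2 + 2`.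
    _ = K * (Real.exp (-(c / 2 * S (2 * m))) * (Real.exp (S (2 * m)) ^ 2)⁻¹) := by
        rw [hK, ← Real.exp_nat_mul, ← Real.exp_neg, ← Real.exp_add, mul_assoc _ (Real.exp _),
          ← Real.exp_add]
        congr 2
        push_cast
        linear_combination -(S (2 * m)) * hεc
    _ ≤ K * (Real.exp (-(c / 2 * S (2 * m))) * (((m : ℝ) + 1) ^ 2)⁻¹) := by gcongr
    _ < Real.exp (-(c / 2 * S (2 * m))) / (m + 1 + c) := by
        have hE := Real.exp_pos (-(c / 2 * S (2 * m)))
        have h1 : K * (m + 1 + c) < ((m : ℝ) + 1) ^ 2 := by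
          have h2 : K * (m + 1 + c) ≤ K * (1 + c) * (m + 1) := by
            have : 0 ≤ K * (c * m) := by positivity
            nlinarith
          have h3 : K * (1 + c) * (m + 1) < m * ((m : ℝ) + 1) := by gcongr
          nlinarith
        rw [lt_div_iff₀ hmc]
        calc _ = Real.exp (-(c / 2 * S (2 * m))) * (K * (m + 1 + c) / ((m : ℝ) + 1) ^ 2) := by
              field_simp
          _ < Real.exp (-(c / 2 * S (2 * m))) * 1 := by
              gcongr
              rwa [div_lt_one (by positivity)]
          _ = _ := mul_one _
    _ ≤ ‖(v : EllTwo) (2 * m + 1)‖ := by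
        rw [div_le_iff₀' hmc]
        exact hlow

theorem theorem2p2 :
    (∀ a q : ℕ → ℝ, IsAdmissibleJacobi a q →
      ∀ r s : ℝ, IsSpectralGap (jacobiOp a q) r s →
      ∀ ε ∈ Set.Ioo (0 : ℝ) (1 / 2), ∃ N : ℕ, ∀ x ∈ Set.Ioo r s, ∀ n > N,
        ‖inner ℂ (opResolvent (jacobiOp a q) (x : ℂ) (basisVec 0)) (basisVec n)‖ ≤
          (s - r) / (ε * (x - r) * (s - x)) *
            Real.exp (-(1 / 2 - ε) * Real.sqrt ((x - r) * (s - x)) *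
              ∑ k ∈ Finset.Ico N n, 1 / a k)) ∧
    (∀ ε : ℝ, 0 < ε → ∃ a q : ℕ → ℝ, IsAdmissibleJacobi a q ∧
      ∃ r s : ℝ, IsSpectralGap (jacobiOp a q) r s ∧
      ∀ (C : ℝ) (N : ℕ), ∃ x ∈ Set.Ioo r s, ∃ n > N,
        C * ((s - r) / ((x - r) * (s - x))) *
            Real.exp (-(1 / 2 + ε) * Real.sqrt ((x - r) * (s - x)) *
              ∑ k ∈ Finset.Ico N n, 1 / a k) <
          ‖inner ℂ (opResolvent (jacobiOp a q) (x : ℂ) (basisVec 0)) (basisVec n)‖) := by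
  exact ⟨fun a q hJ r s hgap ε hε => exists_green_bound hJ hgap hε, fun ε hε =>
    -- The half-width `c = 2 / ε` makes the excess rate `ε c` equal to `2`.
    ⟨staggeredWeight (2 / ε), 0, isAdmissibleJacobi_staggeredWeight (by positivity), -(2 / ε),
      2 / ε, isSpectralGap_staggered (by positivity), fun C N =>
        exists_green_gt hε (by positivity) (by field_simp) C N⟩⟩
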